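/- Let $A$ be a finite-dimensional quantum system with a fixed (incoherent) orthonormal basis $\{|i\rangle\}$, and let $\Phi(\rho)=\sum_i\langle i|\rho|i\rangle\,|i\rangle\langle i|$ be dephasing in this basis. A Kraus operator $K$ on $A$ is *incoherent* if $K|i\rangle\propto|f(i)\rangle$ for all $i$, for some function $f$; it is *strictly incoherent* (SI) if, in addition, the map $\rho\mapsto K\rho K^\dagger$ commutes with $\Phi$. A trace-preserving operation $\mathcal E$ on $A$ is incoherent (resp. SI) if $\mathcal E(\rho)=\sum_\mu K_\mu\rho K_\mu^\dagger$ for some finite family of incoherent (resp. SI) Kraus operators with $\sum_\mu K_\mu^\dagger K_\mu=I$. For a state $\rho$ of $AB$, $B$ finite-dimensional, let $J(B|A)_\rho:=I(A:B)_{\Phi_A(\rho)}$, where $\Phi_A=\Phi\otimes\mathrm{id}_B$, $I(A:B)_\sigma=S(\sigma_A)+S(\sigma_B)-S(\sigma_{AB})$ and $S$ is the von Neumann entropy. $J$ is an *ensemble monotone* under a decomposition $\mathcal E=\sum_x\mathcal E^x$ of a trace-preserving operation on $A$ if $\sum_x p_x\,J(B|A)_{\rho^x}\le J(B|A)_\rho$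 for every $B$ and every state $\rho$ of $AB$, where $p_x\rho^x=(\mathcal E^x\otimes\mathrm{id}_B)(\rho)$ and $\operatorname{tr}\rho^x=1$ (terms with $p_x=0$ being omitted). $J$ is an ensemble monotone under an incoherent operation $\mathcal E$ if $\mathcal E$ has a representation by incoherent Kraus operators $\{K_\mu\}$ such that $J$ is an ensemble monotone under each decomposition $\mathcal E=\sum_x\mathcal E^x$ that arises by recording the Kraus outcome $\mu$ fully, partially or not at all, i.e. $\mathcal E^x(\rho)=\sum_{\mu:\,g(\mu)=x}K_\mu\rho K_\mu^\dagger$ for a function $g$ of the outcomes. Then: 1. The set of SI operations on $A$ is the largest set of incoherent operations on $A$ under each of which $J(B|A)$ is an ensemble monotone: $J$ is an ensemble monotone under every SI operation, and every incoherent operation under which $J$ is an ensemble monotone is SI. 2. More precisely, for every finite family of SI Kraus operators with $\sum_\mu K_\mu^\dagger K_\mu=I$, $J$ is an ensemble monotone under every decomposition obtained by recording the outcome $\mu$ fully, partially or not at all. 3. If $\mathcal E$ is a (trace-preserving) incoherent operation on $A$ that does not commute with $\Phi$, then there is a state $\rho$ of $AB$, with $B$ a qubit, such that $J(B|A)_\rho=0$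 and $J(B|A)_{(\mathcal E\otimes\mathrm{id}_B)(\rho)}>0$. -/

import Mathlib

open scoped Matrix ComplexOrder

noncomputable section

namespace Incoherence

/-- A linear map on operators of the finite-dimensional system `A`, written as matrices in the
fixed incoherent basis `|i⟩`, `i : A`. -/
abbrev Superop (A : Type) [Fintype A] [DecidableEq A] : Type :=
  Matrix A A ℂ →ₗ[ℂ] Matrix A A ℂ

section System

variable {A : Type} [Fintype A] [DecidableEq A]

/-- A quantum state (density matrix). -/
def IsState (ρ : Matrix A A ℂ) : Prop :=
  ρ.PosSemidef ∧ ρ.trace = 1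

/-- The map `ρ ↦ K ρ K†` of a single Kraus operator. -/
def krausMap (K : Matrix A A ℂ) : Superop A where
  toFun ρ := K * ρ * Kᴴ
  map_add' ρ σ := by rw [Matrix.mul_add, Matrix.add_mul]
  map_smul' c ρ := by simp

/-- Dephasing in the incoherent basis, `Φ(ρ) = ∑ i, ⟨i|ρ|i⟩ |i⟩⟨i|`. -/
def dephase : Superop A where
  toFun ρ := Matrix.diagonal fun i => ρ i i
  map_add' ρ σ := by
    rw [Matrix.diagonal_add]; rfl
  map_smul' c ρ := by
    rw [RingHom.id_apply, ← Matrix.diagonal_smul]; rfl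

/-- `[E, Φ] = 0`. -/
def CommutesWithDephasing (E : Superop A) : Prop :=
  E ∘ₗ dephase = dephase ∘ₗ E

/-- An incoherent Kraus operator: `K |i⟩ ∝ |f i⟩` for some function `f`. -/
def IsIncoherentKraus (K : Matrix A A ℂ) : Prop :=
  ∃ f : A → A, ∀ i k, k ≠ f i → K k i = 0

/-- A strictly incoherent (SI) Kraus operator: incoherent, and `ρ ↦ K ρ K†` commutes with
dephasing. -/
def IsSIKraus (K : Matrix A A ℂ) : Prop :=
  IsIncoherentKraus K ∧ CommutesWithDephasing (krausMap K)

/-- `K` is a Kraus representation of the trace-preserving operation `E`. -/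
def IsKrausRep (E : Superop A) {m : ℕ} (K : Fin m → Matrix A A ℂ) : Prop :=
  ∑ μ, (K μ)ᴴ * K μ = 1 ∧ E = ∑ μ, krausMap (K μ)

/-- A (trace-preserving) incoherent operation. -/
def IsIncoherentOp (E : Superop A) : Prop :=
  ∃ (m : ℕ) (K : Fin m → Matrix A A ℂ), IsKrausRep E K ∧ ∀ μ, IsIncoherentKraus (K μ)

/-- A (trace-preserving) strictly incoherent operation. -/
def IsSIOp (E : Superop A) : Prop :=
  ∃ (m : ℕ) (K : Fin m → Matrix A A ℂ), IsKrausRep E K ∧ ∀ μ, IsSIKraus (K μ)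

open Classical in
/-- The von Neumann entropy `S(ρ) = - tr (ρ log ρ)`, as the sum of `- λ log λ` over the
eigenvalues of the Hermitian matrix `ρ` (and `0` by convention if `ρ` is not Hermitian). -/
def entropy (ρ : Matrix A A ℂ) : ℝ :=
  if h : ρ.IsHermitian then ∑ i, Real.negMulLog (h.eigenvalues i) else 0

end System

section Bipartite

variable {A B : Type} [Fintype A] [DecidableEq A] [Fintype B] [DecidableEq B]

/-- The reduced state `ρ_A = tr_B ρ`. -/
def reduceA (ρ : Matrix (A × B) (A × B) ℂ) : Matrix A A ℂ :=
  Matrix.of fun i j => ∑ b, ρ (i, b) (j, b)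

/-- The reduced state `ρ_B = tr_A ρ`. -/
def reduceB (ρ : Matrix (A × B) (A × B) ℂ) : Matrix B B ℂ :=
  Matrix.of fun b c => ∑ i, ρ (i, b) (i, c)

/-- The local action `E_A = E ⊗ id_B`: `E` is applied to each block `(⟨b|ρ|c⟩)` of `ρ`. -/
def onA (E : Superop A) (ρ : Matrix (A × B) (A × B) ℂ) : Matrix (A × B) (A × B) ℂ :=
  Matrix.of fun x y => E (Matrix.of fun i j => ρ (i, x.2) (j, y.2)) x.1 y.1

/-- The mutual information `I(A:B) = S(ρ_A) + S(ρ_B) - S(ρ_AB)`. -/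
def mutualInfo (ρ : Matrix (A × B) (A × B) ℂ) : ℝ :=
  entropy (reduceA ρ) + entropy (reduceB ρ) - entropy ρ

/-- The classical correlations `J(B|A)_ρ = I(A:B)` of the state `Φ_A(ρ)`. -/
def classicalCorr (ρ : Matrix (A × B) (A × B) ℂ) : ℝ :=
  mutualInfo (onA dephase ρ)

/-- The probability `tr E_A(ρ)` of the outcome described by the suboperation `E` on `A`. -/
def outcomeProb (E : Superop A) (ρ : Matrix (A × B) (A × B) ℂ) : ℝ :=
  (onA E ρ).trace.re

/-- The normalised state after that outcome (used only with the weight `outcomeProb E ρ`, so its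
value is irrelevant when the probability vanishes). -/
def outcomeState (E : Superop A) (ρ : Matrix (A × B) (A × B) ℂ) : Matrix (A × B) (A × B) ℂ :=
  (outcomeProb E ρ)⁻¹ • onA E ρ

end Bipartite

section Monotone

variable {A : Type} [Fintype A] [DecidableEq A]

/-- `J(B|A)` is an ensemble monotone under the decomposition `∑ x, F x` of an operation on `A`:
`∑ x, p_x J(ρ^x) ≤ J(ρ)` for every finite-dimensional `B` and every state `ρ` of `AB`. -/
def IsEnsembleMonotone {r : ℕ} (F : Fin r → Superop A) : Prop :=
  ∀ (n : ℕ) (ρ : Matrix (A × Fin n) (A × Fin n) ℂ), IsState ρ →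
    ∑ x, outcomeProb (F x) ρ * classicalCorr (outcomeState (F x) ρ) ≤ classicalCorr ρ

/-- The suboperations obtained when, of the Kraus outcome `μ`, only the value `g μ` is recorded.
An injective `g` keeps the full record, a constant `g` keeps none. -/
def recorded {m r : ℕ} (K : Fin m → Matrix A A ℂ) (g : Fin m → Fin r) : Fin r → Superop A :=
  fun x => ∑ μ with g μ = x, krausMap (K μ)

/-- `J(B|A)` is an ensemble monotone under the incoherent operation `E` on `A`: for some
representation of `E` by incoherent Kraus operators, it is an ensemble monotone under each
decomposition `E = ∑ x, E^x` got by recording the Kraus outcome, fully, partially or not at all. -/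
def IsEnsembleMonotoneUnder (E : Superop A) : Prop :=
  ∃ (m : ℕ) (K : Fin m → Matrix A A ℂ), IsKrausRep E K ∧ (∀ μ, IsIncoherentKraus (K μ)) ∧
    ∀ (r : ℕ) (g : Fin m → Fin r), IsEnsembleMonotone (recorded K g)

end Monotone

end Incoherence

end

/-! For a state, J(B|A) is the Holevo quantity of the ensemble of states of B conditioned on the
incoherent outcomes on A (`classicalCorr_eq_holevo`). Weighting entropies by traces (`massEntropy`)
makes it homogeneous of degree one, so outcome probabilities are absorbed, and concavity of entropy
becomes superadditivity (`massEntropy_add`).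

SI operators mix the conditional states of B by classical transition weights
(`condB_onA_sum_krausMap`), which sum to one over all outcomes and final levels. Superadditivity,
applied to the reduced state and to the conditional states separately, then gives monotonicity for
every record.

Conversely, write z_k for the amplitude with which the coherence |i⟩⟨j| reaches population k, and
t_k for population k of the image of the identity. A qubit storing the sign of an i-j coherence has
J = 0 with A, but becomes correlated unless z_k t_l = z_l t_k (`exists_holevo_pos`). If this held
for a fixed k and all l, summing over l would give z_k · dim A = 0, because trace preservation makes
the z_l sum to 0 and the t_l to dim A. So an incoherent operation that does not commute with Φ
creates J from zero.

For maximality, monotonicity without a record forces commutation with Φ. With a full record, the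
same witness forces each non-SI Kraus operator to have a single nonzero row. The non-SI operators
together still commute with Φ, so they form a measure-and-prepare map, which has a Kraus
representation by single-entry, hence SI, operators. -/

noncomputable section

namespace Incoherence

set_option linter.unusedSectionVars false

/-! ### Trace-weighted entropy and its superadditivity -/

section Entropy

open Real

/-- Joint superadditivity of the perspective `s * negMulLog (x / s)` of `negMulLog`, with its
equality case. -/
lemma negMulLog_perspective_add {x y s t : ℝ} (hx : 0 ≤ x) (hxs : x ≤ s) (hy : 0 ≤ y)
    (hyt : y ≤ t) :
    (negMulLog x + x * log s) + (negMulLog y + y * log t) ≤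
        negMulLog (x + y) + (x + y) * log (s + t) ∧
      (x * t ≠ y * s →
        (negMulLog x + x * log s) + (negMulLog y + y * log t) <
          negMulLog (x + y) + (x + y) * log (s + t)) := by
  -- When s = 0, the bound x ≤ s forces x = 0; both sides then agree and the premise of the strict
  -- claim is false.
  rcases (hx.trans hxs).eq_or_lt with rfl | hs
  · obtain rfl : x = 0 := le_antisymm hxs hx
    simp
  rcases (hy.trans hyt).eq_or_lt with rfl | ht
  · obtain rfl : y = 0 := le_antisymm hyt hy
    simp
  have persp : ∀ {a c : ℝ}, 0 < c → negMulLog a + a * log c = c * negMulLog (a / c) := by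
    intro a c hc
    have h := negMulLog_mul c (a / c)
    rw [mul_div_cancel₀ _ hc.ne'] at h
    rw [h]
    simp only [negMulLog]
    field_simp
    ring
  have hst : 0 < s + t := by positivity
  rw [persp hs, persp ht, persp hst]
  have e : (x + y) / (s + t) = (s / (s + t)) • (x / s) + (t / (s + t)) • (y / t) := by
    simp only [smul_eq_mul]; field_simp
  have e1 : s / (s + t) + t / (s + t) = 1 := by field_simp
  have mx : x / s ∈ Set.Ici (0 : ℝ) := div_nonneg hx hs.le
  have my : y / t ∈ Set.Ici (0 : ℝ) := div_nonneg hy ht.le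
  have e2 : s * negMulLog (x / s) + t * negMulLog (y / t) =
      (s + t) * ((s / (s + t)) • negMulLog (x / s) + (t / (s + t)) • negMulLog (y / t)) := by
    simp only [smul_eq_mul]; field_simp
  rw [e2, e]
  refine ⟨mul_le_mul_of_nonneg_left
    (concaveOn_negMulLog.2 mx my (by positivity) (by positivity) e1) hst.le, fun hne => ?_⟩
  refine mul_lt_mul_of_pos_left
    (strictConcaveOn_negMulLog.2 mx my (fun h => hne ?_) (by positivity) (by positivity) e1) hst
  rw [div_eq_div_iff hs.ne' ht.ne'] at h
  exact h

variable {ι : Type} [Fintype ι]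

/-- The Shannon entropy of a finite non-negative vector, weighted by its total mass. -/
def massShannon (v : ι → ℝ) : ℝ :=
  ∑ i, negMulLog (v i) - negMulLog (∑ i, v i)

/-- Each summand is a perspective s η(x/s) with s the total mass, so superadditivity can be proved
coordinate by coordinate. -/
lemma massShannon_eq_sum (v : ι → ℝ) :
    massShannon v = ∑ i, (negMulLog (v i) + v i * log (∑ j, v j)) := by
  rw [massShannon, Finset.sum_add_distrib, ← Finset.sum_mul]
  simp only [negMulLog]
  ring

lemma massShannon_add {v w : ι → ℝ} (hv : ∀ i, 0 ≤ v i) (hw : ∀ i, 0 ≤ w i) :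
    massShannon v + massShannon w ≤ massShannon (v + w) := by
  simp only [massShannon_eq_sum, ← Finset.sum_add_distrib, Pi.add_apply]
  refine Finset.sum_le_sum fun i _ => ?_
  rw [Finset.sum_add_distrib]
  exact (negMulLog_perspective_add (hv i)
    (Finset.single_le_sum (fun j _ => hv j) (Finset.mem_univ i)) (hw i)
    (Finset.single_le_sum (fun j _ => hw j) (Finset.mem_univ i))).1

lemma massShannon_add_lt {v w : ι → ℝ} (hv : ∀ i, 0 ≤ v i) (hw : ∀ i, 0 ≤ w i) {i : ι}
    (hne : v i * ∑ j, w j ≠ w i * ∑ j, v j) :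
    massShannon v + massShannon w < massShannon (v + w) := by
  have key := fun k => negMulLog_perspective_add (hv k)
    (Finset.single_le_sum (fun j _ => hv j) (Finset.mem_univ k)) (hw k)
    (Finset.single_le_sum (fun j _ => hw j) (Finset.mem_univ k))
  simp only [massShannon_eq_sum, ← Finset.sum_add_distrib, Pi.add_apply]
  refine Finset.sum_lt_sum (fun k _ => ?_) ⟨i, Finset.mem_univ i, ?_⟩
  · rw [Finset.sum_add_distrib]; exact (key k).1
  · rw [Finset.sum_add_distrib]; exact (key i).2 hne

variable [DecidableEq ι]

-- Entropy sees only the multiset of roots of the characteristic polynomial; this covers unitary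
-- conjugates and block-diagonal matrices without matching up eigenvalue orderings.
open Polynomial in
lemma entropy_eq_of_charpoly {ρ : Matrix ι ι ℂ} (h : ρ.IsHermitian) {d : ι → ℝ}
    (hd : ρ.charpoly = ∏ i, (X - C (d i : ℂ))) : entropy ρ = ∑ i, negMulLog (d i) := by
  have h1 := h.roots_charpoly_eq_eigenvalues
  have h2 : (∏ i, (X - C (d i : ℂ))).roots =
      Multiset.map (fun i => (d i : ℂ)) Finset.univ.val := by
    rw [Polynomial.roots_prod]
    · simp
    · simp [Finset.prod_ne_zero_iff, Polynomial.X_sub_C_ne_zero]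
  rw [hd, h2] at h1
  have h3 := congrArg (fun s => (Multiset.map (fun z : ℂ => negMulLog z.re) s).sum) h1
  simp only [Multiset.map_map, Function.comp_def, Complex.ofReal_re] at h3
  rw [entropy, dif_pos h]
  exact h3.symm

lemma entropy_unitary_conj (U : Matrix.unitaryGroup ι ℂ) (d : ι → ℝ) :
    entropy ((U : Matrix ι ι ℂ) * Matrix.diagonal (fun i => (d i : ℂ)) * star (U : Matrix ι ι ℂ)) =
      ∑ i, negMulLog (d i) := by
  refine entropy_eq_of_charpoly ?_ ?_
  · refine Matrix.isHermitian_mul_mul_conjTranspose _ ?_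
    exact Matrix.isHermitian_diagonal_of_self_adjoint _ (funext fun i => Complex.conj_ofReal _)
  · rw [Matrix.charpoly_mul_comm, ← mul_assoc]
    simp [Matrix.charpoly_diagonal]

lemma entropy_diagonal (d : ι → ℝ) :
    entropy (Matrix.diagonal fun i => (d i : ℂ)) = ∑ i, negMulLog (d i) := by
  simpa using entropy_unitary_conj 1 d

lemma entropy_smul {ρ : Matrix ι ι ℂ} (h : ρ.IsHermitian) (c : ℝ) :
    entropy (c • ρ) = c * entropy ρ + negMulLog c * ρ.trace.re := by
  have hs := h.spectral_theorem
  rw [Unitary.conjStarAlgAut_apply] at hs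
  have e : c • ρ = (h.eigenvectorUnitary : Matrix ι ι ℂ) *
      Matrix.diagonal (fun i => ((c * h.eigenvalues i : ℝ) : ℂ)) *
      star (h.eigenvectorUnitary : Matrix ι ι ℂ) := by
    conv_lhs => rw [hs]
    rw [← Matrix.smul_mul, ← Matrix.mul_smul, ← Matrix.diagonal_smul]
    congr 3
    ext i
    simp
  rw [e, entropy_unitary_conj, entropy, dif_pos h, h.trace_eq_sum_eigenvalues]
  simp only [negMulLog_mul, Complex.re_sum, Finset.sum_add_distrib, Finset.mul_sum]
  rw [add_comm]
  congr 1
  exact Finset.sum_congr rfl fun i _ => mul_comm _ _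

lemma sum_normSq_row_of_unitary {W : Matrix ι ι ℂ} (h : W * Wᴴ = 1) (i : ι) :
    ∑ j, Complex.normSq (W i j) = 1 := by
  have := congrFun (congrFun h i) i
  simp only [Matrix.mul_apply, Matrix.conjTranspose_apply, Complex.star_def, Complex.mul_conj,
    Matrix.one_apply_eq] at this
  exact_mod_cast this

/-- Pinching to the diagonal of any orthonormal basis does not decrease the entropy. -/
lemma entropy_le_sum_diag {ρ : Matrix ι ι ℂ} (h : ρ.PosSemidef) (U : Matrix.unitaryGroup ι ℂ) :
    entropy ρ ≤
      ∑ i, negMulLog ((star (U : Matrix ι ι ℂ) * ρ * (U : Matrix ι ι ℂ)) i i).re := by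
  set V : Matrix ι ι ℂ := (h.1.eigenvectorUnitary : Matrix ι ι ℂ) with hV
  set ev := h.1.eigenvalues with hev
  set W : Matrix ι ι ℂ := star (U : Matrix ι ι ℂ) * V with hW
  have hs := h.1.spectral_theorem
  rw [Unitary.conjStarAlgAut_apply] at hs
  have hU1 : (U : Matrix ι ι ℂ) * star (U : Matrix ι ι ℂ) = 1 := Unitary.coe_mul_star_self U
  have hU2 : star (U : Matrix ι ι ℂ) * (U : Matrix ι ι ℂ) = 1 := Unitary.coe_star_mul_self U
  have hV1 : V * star V = 1 := Unitary.coe_mul_star_self _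
  have hV2 : star V * V = 1 := Unitary.coe_star_mul_self _
  have hW1 : W * Wᴴ = 1 := by
    rw [← Matrix.star_eq_conjTranspose, hW, star_mul, star_star]
    calc star (U : Matrix ι ι ℂ) * V * (star V * (U : Matrix ι ι ℂ))
        = star (U : Matrix ι ι ℂ) * (V * star V) * (U : Matrix ι ι ℂ) := by noncomm_ring
      _ = 1 := by rw [hV1, mul_one, hU2]
  have hW2 : Wᴴ * Wᴴᴴ = 1 := by
    rw [Matrix.conjTranspose_conjTranspose, ← Matrix.star_eq_conjTranspose, hW, star_mul, star_star]
    calc star V * (U : Matrix ι ι ℂ) * (star (U : Matrix ι ι ℂ) * V)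
        = star V * ((U : Matrix ι ι ℂ) * star (U : Matrix ι ι ℂ)) * V := by noncomm_ring
      _ = 1 := by rw [hU1, mul_one, hV2]
  -- The matrix |W i j|² is doubly stochastic: unit row sums permit Jensen's inequality, and unit
  -- column sums collapse the final sum to the eigenvalues.
  have row := sum_normSq_row_of_unitary hW1
  have col : ∀ j, ∑ i, Complex.normSq (W i j) = 1 := by
    intro j
    simpa [Matrix.conjTranspose_apply, Complex.star_def, Complex.normSq_conj] using
      sum_normSq_row_of_unitary hW2 j
  have entry : ∀ i, ((star (U : Matrix ι ι ℂ) * ρ * (U : Matrix ι ι ℂ)) i i).re =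
      ∑ j, Complex.normSq (W i j) * ev j := by
    intro i
    have e : star (U : Matrix ι ι ℂ) * ρ * (U : Matrix ι ι ℂ) =
        W * Matrix.diagonal (fun j => (ev j : ℂ)) * Wᴴ := by
      rw [← Matrix.star_eq_conjTranspose, hW, star_mul, star_star]
      conv_lhs => rw [hs]
      simp only [mul_assoc]
      rfl
    rw [e, Matrix.mul_apply, Complex.re_sum]
    refine Finset.sum_congr rfl fun j _ => ?_
    rw [Matrix.mul_diagonal, Matrix.conjTranspose_apply, Complex.star_def, mul_right_comm,
      Complex.mul_conj, ← Complex.ofReal_mul, Complex.ofReal_re]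
  have hle : ∀ i, ∑ j, Complex.normSq (W i j) * negMulLog (ev j) ≤
      negMulLog ((star (U : Matrix ι ι ℂ) * ρ * (U : Matrix ι ι ℂ)) i i).re := by
    intro i
    rw [entry]
    exact concaveOn_negMulLog.le_map_sum (fun j _ => Complex.normSq_nonneg _) (row i)
      (fun j _ => h.eigenvalues_nonneg j)
  refine le_trans (le_of_eq ?_) (Finset.sum_le_sum fun i _ => hle i)
  rw [Finset.sum_comm, entropy, dif_pos h.1]
  refine Finset.sum_congr rfl fun j _ => ?_
  rw [← Finset.sum_mul, col, one_mul]

/-- The von Neumann entropy of the normalised operator, weighted by the trace: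
`tr ρ * S (ρ / tr ρ) = S ρ - η (tr ρ)` with `η x = - x log x`. -/
def massEntropy (ρ : Matrix ι ι ℂ) : ℝ :=
  entropy ρ - negMulLog ρ.trace.re

lemma massEntropy_smul {ρ : Matrix ι ι ℂ} (h : ρ.IsHermitian) (c : ℝ) :
    massEntropy (c • ρ) = c * massEntropy ρ := by
  rw [massEntropy, massEntropy, entropy_smul h, Matrix.trace_smul, Complex.smul_re, smul_eq_mul,
    negMulLog_mul]
  ring

lemma massEntropy_diagonal (d : ι → ℝ) :
    massEntropy (Matrix.diagonal fun i => (d i : ℂ)) = massShannon d := by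
  rw [massEntropy, entropy_diagonal, Matrix.trace_diagonal, massShannon, ← Complex.ofReal_sum,
    Complex.ofReal_re]

lemma massEntropy_zero : massEntropy (0 : Matrix ι ι ℂ) = 0 := by
  simpa using massEntropy_smul (Matrix.isHermitian_zero (n := ι) (α := ℂ)) 0

lemma trace_unitary_conj (U : Matrix.unitaryGroup ι ℂ) (ρ : Matrix ι ι ℂ) :
    ∑ i, ((star (U : Matrix ι ι ℂ) * ρ * (U : Matrix ι ι ℂ)) i i).re = ρ.trace.re := by
  have : (star (U : Matrix ι ι ℂ) * ρ * (U : Matrix ι ι ℂ)).trace = ρ.trace := by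
    rw [Matrix.trace_mul_comm, ← mul_assoc, Unitary.mul_star_self_of_mem U.2, one_mul]
  rw [← this, Matrix.trace, Complex.re_sum]
  rfl

/-- Pinch in an eigenbasis of ρ + σ: this can only raise the entropies of ρ and σ and leaves that of
ρ + σ unchanged, which reduces the claim to `massShannon_add`. -/
lemma massEntropy_add {ρ σ : Matrix ι ι ℂ} (hρ : ρ.PosSemidef) (hσ : σ.PosSemidef) :
    massEntropy ρ + massEntropy σ ≤ massEntropy (ρ + σ) := by
  have h := (hρ.add hσ).1
  set U := h.eigenvectorUnitary with hU
  let d : Matrix ι ι ℂ → ι → ℝ := fun τ i =>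
    ((star (U : Matrix ι ι ℂ) * τ * (U : Matrix ι ι ℂ)) i i).re
  have le : ∀ {τ : Matrix ι ι ℂ}, τ.PosSemidef → massEntropy τ ≤ massShannon (d τ) := by
    intro τ hτ
    have := entropy_le_sum_diag hτ U
    rw [massEntropy, massShannon]
    simp only [d, trace_unitary_conj]
    linarith
  have nonneg : ∀ {τ : Matrix ι ι ℂ}, τ.PosSemidef → ∀ i, 0 ≤ d τ i := by
    intro τ hτ i
    exact (Complex.le_def.1 (hτ.conjTranspose_mul_mul_same (U : Matrix ι ι ℂ)).diag_nonneg).1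
  have hadd : d (ρ + σ) = d ρ + d σ := by
    ext i
    simp [d, mul_add, add_mul]
  have heq : massEntropy (ρ + σ) = massShannon (d (ρ + σ)) := by
    rw [massEntropy, massShannon]
    simp only [d, trace_unitary_conj]
    rw [entropy, dif_pos h]
    congr 1
    refine Finset.sum_congr rfl fun i _ => ?_
    have := h.conjStarAlgAut_star_eigenvectorUnitary
    rw [Unitary.conjStarAlgAut_star_apply] at this
    rw [this]
    simp
  rw [heq, hadd]
  exact (add_le_add (le hρ) (le hσ)).trans (massShannon_add (nonneg hρ) (nonneg hσ))

lemma sum_massEntropy_le {κ : Type} (s : Finset κ) {ρ : κ → Matrix ι ι ℂ}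
    (h : ∀ k ∈ s, (ρ k).PosSemidef) :
    ∑ k ∈ s, massEntropy (ρ k) ≤ massEntropy (∑ k ∈ s, ρ k) := by
  classical
  induction s using Finset.induction_on with
  | empty => simp [massEntropy_zero]
  | insert a s ha ih =>
    rw [Finset.sum_insert ha, Finset.sum_insert ha]
    have hs : ∀ k ∈ s, (ρ k).PosSemidef := fun k hk => h k (Finset.mem_insert_of_mem hk)
    exact (add_le_add_right (ih hs) _).trans
      (massEntropy_add (h a (Finset.mem_insert_self a s)) (Matrix.posSemidef_sum s hs))

end Entropy

/-! ### Classical correlations as a Holevo quantity -/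

section Holevo

variable {A B : Type} [Fintype A] [DecidableEq A] [Fintype B] [DecidableEq B]

/-- The unnormalised conditional state `⟨k|ρ|k⟩` of `B` given the incoherent outcome `k` on `A`. -/
def condB (ρ : Matrix (A × B) (A × B) ℂ) (k : A) : Matrix B B ℂ :=
  ρ.submatrix (Prod.mk k) (Prod.mk k)

/-- The Holevo quantity of the ensemble of conditional states `condB ρ k`, in the form that is
homogeneous of degree one in `ρ`. -/
def holevo (ρ : Matrix (A × B) (A × B) ℂ) : ℝ :=
  massEntropy (reduceB ρ) - ∑ k, massEntropy (condB ρ k)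

lemma reduceB_eq_sum_condB (ρ : Matrix (A × B) (A × B) ℂ) : reduceB ρ = ∑ k, condB ρ k := by
  ext b c
  simp [reduceB, condB, Matrix.sum_apply]

lemma posSemidef_condB {ρ : Matrix (A × B) (A × B) ℂ} (h : ρ.PosSemidef) (k : A) :
    (condB ρ k).PosSemidef :=
  h.submatrix _

lemma posSemidef_reduceB {ρ : Matrix (A × B) (A × B) ℂ} (h : ρ.PosSemidef) :
    (reduceB ρ).PosSemidef := by
  rw [reduceB_eq_sum_condB]
  exact Matrix.posSemidef_sum _ fun k _ => posSemidef_condB h k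

lemma trace_reduceB (ρ : Matrix (A × B) (A × B) ℂ) : (reduceB ρ).trace = ρ.trace := by
  simp only [Matrix.trace, Matrix.diag_apply, reduceB, Matrix.of_apply, Fintype.sum_prod_type]
  exact Finset.sum_comm

lemma holevo_nonneg {ρ : Matrix (A × B) (A × B) ℂ} (h : ρ.PosSemidef) : 0 ≤ holevo ρ := by
  rw [holevo, reduceB_eq_sum_condB, sub_nonneg]
  exact sum_massEntropy_le _ fun k _ => posSemidef_condB h k

lemma holevo_smul {ρ : Matrix (A × B) (A × B) ℂ} (h : ρ.PosSemidef) (c : ℝ) :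
    holevo (c • ρ) = c * holevo ρ := by
  have e1 : reduceB (c • ρ) = c • reduceB ρ := by
    ext b d
    simp [reduceB, Finset.mul_sum]
  have e2 : ∀ k, condB (c • ρ) k = c • condB ρ k := fun k => rfl
  simp only [holevo, e1, e2, massEntropy_smul (posSemidef_reduceB h).1,
    massEntropy_smul (posSemidef_condB h _).1, mul_sub, Finset.mul_sum]

lemma onA_dephase_eq (ρ : Matrix (A × B) (A × B) ℂ) :
    onA dephase ρ = Matrix.reindex (Equiv.prodComm B A) (Equiv.prodComm B A)
      (Matrix.blockDiagonal (condB ρ)) := by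
  ext ⟨i, b⟩ ⟨j, c⟩
  simp only [onA, dephase, Matrix.of_apply, LinearMap.coe_mk, AddHom.coe_mk,
    Matrix.diagonal_apply, Matrix.reindex_apply, Matrix.submatrix_apply, Equiv.prodComm_symm,
    Equiv.prodComm_apply, Prod.swap, Matrix.blockDiagonal_apply, condB]

lemma charpoly_blockDiagonal (M : A → Matrix B B ℂ) :
    (Matrix.blockDiagonal M).charpoly = ∏ k, (M k).charpoly := by
  have : (Matrix.blockDiagonal M).charmatrix =
      Matrix.blockDiagonal fun k => (M k).charmatrix := by
    ext ⟨b, i⟩ ⟨c, j⟩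
    simp only [Matrix.charmatrix_apply, Matrix.blockDiagonal_apply, Matrix.diagonal_apply,
      Prod.mk.injEq]
    by_cases h : i = j <;> simp [h]
  rw [Matrix.charpoly, this, Matrix.det_blockDiagonal]
  rfl

lemma entropy_onA_dephase {ρ : Matrix (A × B) (A × B) ℂ} (h : ρ.IsHermitian) :
    entropy (onA dephase ρ) = ∑ k, entropy (condB ρ k) := by
  have hc : ∀ k, (condB ρ k).IsHermitian := fun k => h.submatrix _
  have hH : (onA dephase ρ).IsHermitian := by
    have hb : (Matrix.blockDiagonal (condB ρ)).IsHermitian :=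
      (Matrix.blockDiagonal_conjTranspose _).trans (congrArg _ (funext fun k => hc k))
    rw [onA_dephase_eq, Matrix.reindex_apply]
    exact hb.submatrix _
  rw [entropy_eq_of_charpoly (d := fun x : A × B => (hc x.1).eigenvalues x.2) hH,
    Fintype.sum_prod_type]
  · refine Finset.sum_congr rfl fun k _ => ?_
    rw [entropy, dif_pos (hc k)]
  · rw [onA_dephase_eq, Matrix.charpoly_reindex, charpoly_blockDiagonal, Fintype.prod_prod_type]
    exact Finset.prod_congr rfl fun k _ => (hc k).charpoly_eq

/-- For a state, the classical correlations are the Holevo quantity. -/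
lemma classicalCorr_eq_holevo {ρ : Matrix (A × B) (A × B) ℂ} (h : IsState ρ) :
    classicalCorr ρ = holevo ρ := by
  have hB : reduceB (onA dephase ρ) = reduceB ρ := by
    ext b c
    simp [reduceB, onA, dephase]
  have hA : reduceA (onA dephase ρ) =
      Matrix.diagonal fun k => (((condB ρ k).trace.re : ℝ) : ℂ) := by
    have hre : ∀ k, (((condB ρ k).trace.re : ℝ) : ℂ) = (condB ρ k).trace := fun k =>
      Complex.ext rfl (Complex.le_def.1 (posSemidef_condB h.1 k).trace_nonneg).2
    ext i j
    simp only [reduceA, onA, dephase, hre, Matrix.of_apply, LinearMap.coe_mk, AddHom.coe_mk,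
      Matrix.diagonal_apply]
    by_cases hij : i = j <;> simp [hij, condB, Matrix.trace]
  -- S(A) is the Shannon entropy of the block traces, which is exactly the correction in the
  -- `massEntropy` of the blocks; the correction for B is η(1) = 0.
  rw [classicalCorr, mutualInfo, hA, hB, entropy_diagonal, entropy_onA_dephase h.1.1, holevo]
  simp only [massEntropy, trace_reduceB, h.2, Complex.one_re, Real.negMulLog_one,
    Finset.sum_sub_distrib]
  ring

/-- Homogeneity absorbs the normalisation. At probability zero, a positive semidefinite operator of
trace zero vanishes, so both sides are 0. -/
lemma outcomeProb_mul_classicalCorr {F : Superop A} {ρ : Matrix (A × B) (A × B) ℂ}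
    (h : (onA F ρ).PosSemidef) :
    outcomeProb F ρ * classicalCorr (outcomeState F ρ) = holevo (onA F ρ) := by
  have htr : (onA F ρ).trace = (outcomeProb F ρ : ℂ) :=
    Complex.ext rfl (Complex.le_def.1 h.trace_nonneg).2.symm
  have hp : 0 ≤ outcomeProb F ρ := (Complex.le_def.1 h.trace_nonneg).1
  rcases hp.eq_or_lt with h0 | h0
  · rw [← h0, Complex.ofReal_zero, h.trace_eq_zero_iff] at htr
    have := holevo_smul h 0
    rw [zero_smul, zero_mul] at this
    rw [← h0, htr, this, zero_mul]
  · have hs : IsState (outcomeState F ρ) := by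
      refine ⟨h.smul (inv_nonneg.2 hp), ?_⟩
      rw [outcomeState, Matrix.trace_smul, htr, Complex.real_smul, ← Complex.ofReal_mul,
        inv_mul_cancel₀ h0.ne', Complex.ofReal_one]
    rw [classicalCorr_eq_holevo hs, outcomeState, holevo_smul h, mul_inv_cancel_left₀ h0.ne']

end Holevo

/-! ### Kraus maps, dephasing, and monotonicity under SI operators -/

section Operations

variable {A B κ : Type} [Fintype A] [DecidableEq A] [Fintype B] [DecidableEq B]

lemma dephase_apply_same (M : Matrix A A ℂ) (k : A) : dephase M k k = M k k :=
  Matrix.diagonal_apply_eq _ _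

lemma dephase_apply_ne (M : Matrix A A ℂ) {k l : A} (h : k ≠ l) : dephase M k l = 0 :=
  Matrix.diagonal_apply_ne _ h

lemma krausMap_apply (K M : Matrix A A ℂ) (k l : A) :
    krausMap K M k l = ∑ i, ∑ j, M i j * (K k i * star (K l j)) := by
  simp only [krausMap, LinearMap.coe_mk, AddHom.coe_mk, Matrix.mul_apply, Finset.sum_mul,
    Matrix.conjTranspose_apply]
  rw [Finset.sum_comm]
  exact Finset.sum_congr rfl fun i _ => Finset.sum_congr rfl fun j _ => by ring

lemma sum_krausMap_apply (s : Finset κ) (K : κ → Matrix A A ℂ) (M : Matrix A A ℂ) (k l : A) :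
    (∑ μ ∈ s, krausMap (K μ)) M k l =
      ∑ i, ∑ j, M i j * ∑ μ ∈ s, K μ k i * star (K μ l j) := by
  rw [LinearMap.sum_apply, Matrix.sum_apply]
  simp only [krausMap_apply, Finset.mul_sum]
  rw [Finset.sum_comm]
  exact Finset.sum_congr rfl fun i _ => Finset.sum_comm

lemma sum_krausMap_single (s : Finset κ) (K : κ → Matrix A A ℂ) (i j k l : A) :
    (∑ μ ∈ s, krausMap (K μ)) (Matrix.single i j 1) k l = ∑ μ ∈ s, K μ k i * star (K μ l j) := by
  rw [sum_krausMap_apply, Finset.sum_eq_single i, Finset.sum_eq_single j]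
  · simp
  · intro b _ hb; simp [hb.symm]
  · simp
  · intro b _ hb; simp [hb.symm]
  · simp

lemma sum_krausMap_one_diag (s : Finset κ) (K : κ → Matrix A A ℂ) (k : A) :
    (∑ μ ∈ s, krausMap (K μ)) 1 k k = ((∑ μ ∈ s, ∑ i, Complex.normSq (K μ k i) : ℝ) : ℂ) := by
  rw [sum_krausMap_apply, Complex.ofReal_sum]
  simp only [Matrix.one_apply, ite_mul, one_mul, zero_mul, Finset.sum_ite_eq, Finset.mem_univ,
    if_true, Complex.ofReal_sum, Complex.star_def, Complex.mul_conj]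
  exact Finset.sum_comm

lemma sum_krausMap_dephase (s : Finset κ) (K : κ → Matrix A A ℂ) (M : Matrix A A ℂ) (k l : A) :
    (∑ μ ∈ s, krausMap (K μ)) (dephase M) k l =
      ∑ i, M i i * ∑ μ ∈ s, K μ k i * star (K μ l i) := by
  rw [sum_krausMap_apply]
  simp [dephase, Matrix.diagonal_apply, ite_mul]

lemma trace_krausMap (K M : Matrix A A ℂ) : (krausMap K M).trace = (Kᴴ * K * M).trace := by
  rw [krausMap, LinearMap.coe_mk, AddHom.coe_mk, Matrix.trace_mul_comm, ← mul_assoc]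

lemma trace_sum_krausMap (s : Finset κ) (K : κ → Matrix A A ℂ) (M : Matrix A A ℂ) :
    ((∑ μ ∈ s, krausMap (K μ)) M).trace = ((∑ μ ∈ s, (K μ)ᴴ * K μ) * M).trace := by
  rw [LinearMap.sum_apply, Matrix.trace_sum, Finset.sum_mul, Matrix.trace_sum]
  exact Finset.sum_congr rfl fun μ _ => trace_krausMap _ _

/-- The completeness relation depends only on the operation. -/
lemma sum_conjTranspose_mul_eq {κ' : Type} {s : Finset κ} {t : Finset κ'}
    {K : κ → Matrix A A ℂ} {L : κ' → Matrix A A ℂ}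
    (h : ∑ μ ∈ s, krausMap (K μ) = ∑ ν ∈ t, krausMap (L ν)) :
    ∑ μ ∈ s, (K μ)ᴴ * K μ = ∑ ν ∈ t, (L ν)ᴴ * L ν := by
  refine Matrix.ext_iff_trace_mul_right.2 fun M => ?_
  rw [← trace_sum_krausMap, h, trace_sum_krausMap]

lemma IsIncoherentKraus.mul_star_eq_zero {K : Matrix A A ℂ} (h : IsIncoherentKraus K) {k l : A}
    (hkl : k ≠ l) (i : A) : K k i * star (K l i) = 0 := by
  obtain ⟨f, hf⟩ := h
  by_cases hk : k = f i
  · rw [hf i l (fun hl => hkl (hk.trans hl.symm)), star_zero, mul_zero]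
  · rw [hf i k hk, zero_mul]

/-- An operation with incoherent Kraus operators commutes with dephasing as soon as it sends
no coherence into populations. -/
lemma commutesWithDephasing_sum_krausMap {s : Finset κ} {K : κ → Matrix A A ℂ}
    (hK : ∀ μ ∈ s, IsIncoherentKraus (K μ))
    (h : ∀ k i j, i ≠ j → ∑ μ ∈ s, K μ k i * star (K μ k j) = 0) :
    CommutesWithDephasing (∑ μ ∈ s, krausMap (K μ)) := by
  refine LinearMap.ext fun M => ?_
  ext k l
  rw [LinearMap.comp_apply, LinearMap.comp_apply, sum_krausMap_dephase]
  by_cases hkl : k = l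
  · subst hkl
    rw [dephase_apply_same, sum_krausMap_apply]
    refine Finset.sum_congr rfl fun i _ => ?_
    rw [Finset.sum_eq_single i]
    · intro j _ hj; rw [h k i j hj.symm, mul_zero]
    · simp
  · rw [dephase_apply_ne _ hkl]
    refine Finset.sum_eq_zero fun i _ => ?_
    rw [Finset.sum_eq_zero fun μ hμ => (hK μ hμ).mul_star_eq_zero hkl i, mul_zero]

lemma CommutesWithDephasing.sum {s : Finset κ} {F : κ → Superop A}
    (h : ∀ μ ∈ s, CommutesWithDephasing (F μ)) : CommutesWithDephasing (∑ μ ∈ s, F μ) := by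
  refine LinearMap.ext fun M => ?_
  simp only [LinearMap.comp_apply, LinearMap.sum_apply, map_sum]
  exact Finset.sum_congr rfl fun μ hμ => LinearMap.congr_fun (h μ hμ) M

lemma CommutesWithDephasing.apply_diag {E : Superop A} (h : CommutesWithDephasing E)
    (M : Matrix A A ℂ) (k : A) : E M k k = E (dephase M) k k := by
  have := congrFun (congrFun (LinearMap.congr_fun h M) k) k
  rw [LinearMap.comp_apply, LinearMap.comp_apply] at this
  rw [this, dephase_apply_same]

open scoped Kronecker in
lemma onA_krausMap (K : Matrix A A ℂ) (ρ : Matrix (A × B) (A × B) ℂ) :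
    onA (krausMap K) ρ = (K ⊗ₖ (1 : Matrix B B ℂ)) * ρ * (K ⊗ₖ (1 : Matrix B B ℂ))ᴴ := by
  ext ⟨k, b⟩ ⟨l, c⟩
  simp [onA, krausMap, Matrix.mul_apply, Fintype.sum_prod_type, Matrix.kroneckerMap_apply,
    Matrix.one_apply, apply_ite, Finset.sum_mul]

lemma onA_sum (s : Finset κ) (F : κ → Superop A) (ρ : Matrix (A × B) (A × B) ℂ) :
    onA (∑ μ ∈ s, F μ) ρ = ∑ μ ∈ s, onA (F μ) ρ := by
  ext x y
  simp [onA, Matrix.sum_apply]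

lemma posSemidef_onA_sum_krausMap (s : Finset κ) (K : κ → Matrix A A ℂ)
    {ρ : Matrix (A × B) (A × B) ℂ} (h : ρ.PosSemidef) :
    (onA (∑ μ ∈ s, krausMap (K μ)) ρ).PosSemidef := by
  rw [onA_sum]
  refine Matrix.posSemidef_sum _ fun μ _ => ?_
  rw [onA_krausMap]
  exact h.mul_mul_conjTranspose_same _

lemma reduceB_onA {E : Superop A} (hE : ∀ M, (E M).trace = M.trace)
    (ρ : Matrix (A × B) (A × B) ℂ) : reduceB (onA E ρ) = reduceB ρ := by
  ext b c
  exact hE (Matrix.of fun i j => ρ (i, b) (j, c))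

lemma isState_onA_sum_krausMap {s : Finset κ} {K : κ → Matrix A A ℂ}
    (hK : ∑ μ ∈ s, (K μ)ᴴ * K μ = 1) {ρ : Matrix (A × B) (A × B) ℂ} (h : IsState ρ) :
    IsState (onA (∑ μ ∈ s, krausMap (K μ)) ρ) := by
  refine ⟨posSemidef_onA_sum_krausMap s K h.1, ?_⟩
  rw [← trace_reduceB, reduceB_onA, trace_reduceB, h.2]
  intro M
  rw [trace_sum_krausMap, hK, one_mul]

/-- Commutation with Φ hides the input coherences from the output populations, so what remains is a
classical transition matrix. -/
lemma condB_onA_sum_krausMap {s : Finset κ} {K : κ → Matrix A A ℂ}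
    (hE : CommutesWithDephasing (∑ μ ∈ s, krausMap (K μ))) (ρ : Matrix (A × B) (A × B) ℂ) (k : A) :
    condB (onA (∑ μ ∈ s, krausMap (K μ)) ρ) k =
      ∑ j, (∑ μ ∈ s, Complex.normSq (K μ k j)) • condB ρ j := by
  ext b c
  have : condB (onA (∑ μ ∈ s, krausMap (K μ)) ρ) k b c =
      (∑ μ ∈ s, krausMap (K μ)) (Matrix.of fun i j => ρ (i, b) (j, c)) k k := rfl
  rw [this, hE.apply_diag, sum_krausMap_dephase, Matrix.sum_apply]
  refine Finset.sum_congr rfl fun i _ => ?_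
  simp only [Complex.star_def, Complex.mul_conj, Matrix.smul_apply, Complex.real_smul,
    Complex.ofReal_sum, Matrix.of_apply]
  exact mul_comm _ _

lemma sum_normSq_col {s : Finset κ} {K : κ → Matrix A A ℂ} (hK : ∑ μ ∈ s, (K μ)ᴴ * K μ = 1)
    (j : A) : ∑ μ ∈ s, ∑ k, Complex.normSq (K μ k j) = 1 := by
  have := congrFun (congrFun hK j) j
  rw [Matrix.sum_apply, Matrix.one_apply_eq] at this
  simp only [Matrix.mul_apply, Matrix.conjTranspose_apply, Complex.star_def,
    ← Complex.normSq_eq_conj_mul_self] at this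
  exact_mod_cast this

lemma sum_recorded {m r : ℕ} (K : Fin m → Matrix A A ℂ) (g : Fin m → Fin r) :
    ∑ x, recorded K g x = ∑ μ, krausMap (K μ) :=
  Finset.sum_fiberwise _ _ _

/-- Classical correlations are an ensemble monotone under strictly incoherent Kraus operators,
whatever record of the outcome is kept. -/
theorem isEnsembleMonotone_recorded {m r : ℕ} {K : Fin m → Matrix A A ℂ}
    (hK : ∑ μ, (K μ)ᴴ * K μ = 1) (hSI : ∀ μ, IsSIKraus (K μ)) (g : Fin m → Fin r) :
    IsEnsembleMonotone (recorded K g) := by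
  intro n ρ hρ
  have hpsd : ∀ x, (onA (recorded K g x) ρ).PosSemidef := fun x =>
    posSemidef_onA_sum_krausMap _ K hρ.1
  simp only [outcomeProb_mul_classicalCorr (hpsd _)]
  rw [classicalCorr_eq_holevo hρ]
  simp only [holevo, Finset.sum_sub_distrib]
  refine sub_le_sub ?_ ?_
  · refine (sum_massEntropy_le _ fun x _ => posSemidef_reduceB (hpsd x)).trans (le_of_eq ?_)
    have : ∑ x, reduceB (onA (recorded K g x) ρ) = reduceB (onA (∑ x, recorded K g x) ρ) := by
      rw [onA_sum]
      ext b c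
      simp only [Matrix.sum_apply, reduceB, Matrix.of_apply]
      exact Finset.sum_comm
    rw [this, sum_recorded, reduceB_onA]
    intro M
    rw [trace_sum_krausMap, hK, one_mul]
  · have hle : ∀ x k, ∑ j, (∑ μ with g μ = x, Complex.normSq (K μ k j)) *
        massEntropy (condB ρ j) ≤ massEntropy (condB (onA (recorded K g x) ρ) k) := by
      intro x k
      have hcomm : CommutesWithDephasing (∑ μ with g μ = x, krausMap (K μ)) :=
        CommutesWithDephasing.sum fun μ _ => (hSI μ).2
      rw [recorded, condB_onA_sum_krausMap hcomm]
      simp only [← massEntropy_smul (posSemidef_condB hρ.1 _).1]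
      exact sum_massEntropy_le _ fun j _ => (posSemidef_condB hρ.1 j).smul
        (Finset.sum_nonneg fun μ _ => Complex.normSq_nonneg _)
    refine le_trans (le_of_eq ?_)
      (Finset.sum_le_sum fun x _ => Finset.sum_le_sum fun k _ => hle x k)
    -- Completeness makes the transition weights stochastic once all records x and final levels k
    -- are counted.
    have hT : ∀ j, ∑ x, ∑ k, ∑ μ with g μ = x, Complex.normSq (K μ k j) = 1 := by
      intro j
      rw [← sum_normSq_col hK j, ← Finset.sum_fiberwise _ g]
      exact Finset.sum_congr rfl fun x _ => Finset.sum_comm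
    calc ∑ j, massEntropy (condB ρ j)
        = ∑ j, ∑ x, ∑ k, (∑ μ with g μ = x, Complex.normSq (K μ k j)) *
            massEntropy (condB ρ j) := by
          refine Finset.sum_congr rfl fun j _ => ?_
          simp only [← Finset.sum_mul]
          rw [hT, one_mul]
      _ = _ := by
          rw [Finset.sum_comm]
          exact Finset.sum_congr rfl fun x _ => Finset.sum_comm

end Operations

/-! ### Classical registers on B -/

section ClassicalQuantum

variable {A B : Type} [Fintype A] [DecidableEq A] [Fintype B] [DecidableEq B]

open scoped Kronecker in
lemma posSemidef_blockDiagonal {M : B → Matrix A A ℂ} (h : ∀ b, (M b).PosSemidef) :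
    (Matrix.blockDiagonal M).PosSemidef := by
  have e : Matrix.blockDiagonal M =
      ∑ b, M b ⊗ₖ Matrix.diagonal (Pi.single b (1 : ℂ)) := by
    ext ⟨i, b⟩ ⟨j, c⟩
    rw [Matrix.sum_apply, Finset.sum_eq_single b]
    · simp [Matrix.blockDiagonal_apply, Matrix.kroneckerMap_apply, Matrix.diagonal_apply]
    · intro d _ hd
      simp [Matrix.kroneckerMap_apply, Matrix.diagonal_apply, hd.symm]
    · simp
  rw [e]
  refine Matrix.posSemidef_sum _ fun b _ => (h b).kronecker (Matrix.PosSemidef.diagonal ?_)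
  exact Pi.single_nonneg.2 zero_le_one

lemma onA_blockDiagonal (E : Superop A) (M : B → Matrix A A ℂ) :
    onA E (Matrix.blockDiagonal M) = Matrix.blockDiagonal fun b => E (M b) := by
  ext ⟨k, b⟩ ⟨l, c⟩
  by_cases h : b = c
  · simp only [onA, Matrix.of_apply, Matrix.blockDiagonal_apply, h, if_true]
    rfl
  · simp only [onA, Matrix.of_apply, Matrix.blockDiagonal_apply, h, if_false]
    exact congrFun (congrFun (map_zero E) k) l

lemma condB_blockDiagonal {M : B → Matrix A A ℂ} (h : ∀ b, (M b).PosSemidef) (k : A) :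
    condB (Matrix.blockDiagonal M) k = Matrix.diagonal fun b => (((M b k k).re : ℝ) : ℂ) := by
  have hre : ∀ b, (((M b k k).re : ℝ) : ℂ) = M b k k := fun b =>
    Complex.ext rfl (Complex.le_def.1 (h b).diag_nonneg).2
  ext b c
  simp only [hre, condB, Matrix.submatrix_apply, Matrix.blockDiagonal_apply, Matrix.diagonal_apply]

/-- A classical-quantum ensemble with two non-proportional conditional distributions has strictly
positive Holevo quantity. -/
lemma holevo_blockDiagonal_pos {M : B → Matrix A A ℂ} (h : ∀ b, (M b).PosSemidef) {k l : A}
    {b : B} (hne : (M b k k).re * ∑ c, (M c l l).re ≠ (M b l l).re * ∑ c, (M c k k).re) :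
    0 < holevo (Matrix.blockDiagonal M) := by
  have hkl : l ≠ k := by rintro rfl; exact hne rfl
  have hpsd := fun k => posSemidef_condB (posSemidef_blockDiagonal h) k
  have hnn : ∀ k c, 0 ≤ (M c k k).re := fun k c => (Complex.le_def.1 (h c).diag_nonneg).1
  have hmem : l ∈ Finset.univ.erase k := Finset.mem_erase.2 ⟨hkl, Finset.mem_univ l⟩
  -- Strictness on the pair k, l suffices, and there the blocks are diagonal, hence classical; the
  -- remaining blocks are merged by superadditivity.
  have hpair : massEntropy (condB (Matrix.blockDiagonal M) k) +
      massEntropy (condB (Matrix.blockDiagonal M) l) <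
      massEntropy (condB (Matrix.blockDiagonal M) k + condB (Matrix.blockDiagonal M) l) := by
    have := massShannon_add_lt (hnn k) (hnn l) hne
    simp only [condB_blockDiagonal h, Matrix.diagonal_add, massEntropy_diagonal]
    simp only [← Complex.ofReal_add]
    rwa [massEntropy_diagonal]
  rw [holevo, reduceB_eq_sum_condB, sub_pos, ← Finset.add_sum_erase _ _ (Finset.mem_univ k),
    ← Finset.add_sum_erase _ _ (Finset.mem_univ k), ← Finset.add_sum_erase _ _ hmem,
    ← Finset.add_sum_erase _ _ hmem, ← add_assoc, ← add_assoc]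
  refine (add_lt_add_of_lt_of_le hpair (sum_massEntropy_le _ fun j _ => hpsd j)).trans_le ?_
  exact massEntropy_add ((hpsd k).add (hpsd l)) (Matrix.posSemidef_sum _ fun j _ => hpsd j)

end ClassicalQuantum

/-! ### Detecting coherence that reaches the populations -/

section Probe

variable {A κ : Type} [Fintype A] [DecidableEq A]

/-- The identity with an added coherence `c |i⟩⟨j| + c̄ |j⟩⟨i|`. -/
def withCoherence (i j : A) (c : ℂ) : Matrix A A ℂ :=
  1 + (c • Matrix.single i j 1 + star c • Matrix.single j i 1)

/-- For a phase c this is |v⟩⟨v| with v = |i⟩ + c̄|j⟩, plus the projector onto the other basis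
vectors. -/
lemma posSemidef_withCoherence {i j : A} (hij : i ≠ j) {c : ℂ} (hc : c * star c = 1) :
    (withCoherence i j c).PosSemidef := by
  have e : withCoherence i j c =
      Matrix.vecMulVec (Pi.single i 1 + Pi.single j (star c))
        (star (Pi.single i 1 + Pi.single j (star c))) +
      Matrix.diagonal fun l => if l = i ∨ l = j then 0 else 1 := by
    ext a b
    simp only [withCoherence, Matrix.add_apply, Matrix.smul_apply, Matrix.single_apply,
      Matrix.one_apply, Matrix.vecMulVec_apply, Matrix.diagonal_apply, Pi.add_apply,
      Pi.star_apply, Pi.single_apply, smul_eq_mul]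
    have hc' : star c * c = 1 := by rw [mul_comm, hc]
    have hji : j ≠ i := hij.symm
    by_cases ha : a = i
    · subst ha
      by_cases hb : b = a
      · subst hb; simp [hij, hji]
      · by_cases hb' : b = j
        · subst hb'; simp [hij, hji]
        · simp [hb, hb', Ne.symm hb, Ne.symm hb', hij]
    · by_cases ha' : a = j
      · subst ha'
        by_cases hb : b = i
        · subst hb; simp [hij, hji]
        · by_cases hb' : b = a
          · subst hb'; simpa [hij, hji] using hc'.symm
          · simp [hb, hb', Ne.symm hb, Ne.symm hb', hji]
      · by_cases hab : a = b
        · subst hab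
          simp [ha, ha', Ne.symm ha, Ne.symm ha']
        · simp [hab, ha, ha', Ne.symm ha, Ne.symm ha']
  rw [e]
  refine (Matrix.posSemidef_vecMulVec_self_star _).add (Matrix.PosSemidef.diagonal fun l => ?_)
  dsimp only [Pi.zero_apply]
  split_ifs
  · exact le_rfl
  · exact zero_le_one

lemma withCoherence_apply_same {i j : A} (hij : i ≠ j) (c : ℂ) (k : A) :
    withCoherence i j c k k = 1 := by
  have h1 : Matrix.single i j (1 : ℂ) k k = 0 := by
    rw [Matrix.single_apply, if_neg]; rintro ⟨rfl, rfl⟩; exact hij rfl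
  have h2 : Matrix.single j i (1 : ℂ) k k = 0 := by
    rw [Matrix.single_apply, if_neg]; rintro ⟨rfl, rfl⟩; exact hij rfl
  rw [withCoherence, Matrix.add_apply, Matrix.add_apply, Matrix.smul_apply, Matrix.smul_apply, h1,
    h2, smul_zero, smul_zero, add_zero, add_zero, Matrix.one_apply_eq]

lemma sum_krausMap_withCoherence (s : Finset κ) (K : κ → Matrix A A ℂ) (i j k : A) (c : ℂ) :
    ((∑ μ ∈ s, krausMap (K μ)) (withCoherence i j c) k k).re =
      ∑ μ ∈ s, ∑ n, Complex.normSq (K μ k n) +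
        2 * (c * ∑ μ ∈ s, K μ k i * star (K μ k j)).re := by
  have hstar : ∑ μ ∈ s, K μ k j * star (K μ k i) = star (∑ μ ∈ s, K μ k i * star (K μ k j)) := by
    rw [star_sum]
    exact Finset.sum_congr rfl fun μ _ => by rw [star_mul, star_star]
  rw [withCoherence, map_add, map_add, map_smul, map_smul, Matrix.add_apply, Matrix.add_apply,
    Matrix.smul_apply, Matrix.smul_apply, sum_krausMap_single, sum_krausMap_single,
    sum_krausMap_one_diag, hstar]
  simp only [Complex.add_re, Complex.ofReal_re, smul_eq_mul, Complex.star_def, ← map_mul,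
    Complex.conj_re]
  ring

/-- The classical-quantum state carrying in a qubit register the sign of a maximal coherence
between `|i⟩` and `|j⟩`. -/
def probe (i j : A) (w : ℂ) : Matrix (A × Fin 2) (A × Fin 2) ℂ :=
  Matrix.blockDiagonal fun b : Fin 2 =>
    (2 * Fintype.card A : ℝ)⁻¹ • withCoherence i j ((![1, -1] : Fin 2 → ℂ) b * w)

lemma posSemidef_probe_block {i j : A} (hij : i ≠ j) {w : ℂ} (hw : w * star w = 1) (b : Fin 2) :
    ((2 * Fintype.card A : ℝ)⁻¹ •
      withCoherence i j ((![1, -1] : Fin 2 → ℂ) b * w)).PosSemidef := by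
  refine (posSemidef_withCoherence hij ?_).smul (by positivity)
  fin_cases b <;> simpa using hw

lemma condB_probe {i j : A} (hij : i ≠ j) {w : ℂ} (hw : w * star w = 1) (k : A) :
    condB (probe i j w) k =
      Matrix.diagonal fun _ => (((2 * Fintype.card A : ℝ)⁻¹ : ℝ) : ℂ) := by
  rw [probe, condB_blockDiagonal (posSemidef_probe_block hij hw)]
  simp [Matrix.smul_apply, withCoherence_apply_same hij]

lemma isState_probe {i j : A} (hij : i ≠ j) {w : ℂ} (hw : w * star w = 1) :
    IsState (probe i j w) := by
  refine ⟨posSemidef_blockDiagonal (posSemidef_probe_block hij hw), ?_⟩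
  have : Nonempty A := ⟨i⟩
  have : (Fintype.card A : ℂ) ≠ 0 := Nat.cast_ne_zero.2 Fintype.card_ne_zero
  rw [← trace_reduceB, reduceB_eq_sum_condB, Matrix.trace_sum]
  simp [condB_probe hij hw, Matrix.trace_diagonal]
  field_simp

/-- The coherence does not touch the diagonal, so B is in the same conditional state for every
outcome on A. -/
lemma classicalCorr_probe {i j : A} (hij : i ≠ j) {w : ℂ} (hw : w * star w = 1) :
    classicalCorr (probe i j w) = 0 := by
  rw [classicalCorr_eq_holevo (isState_probe hij hw), holevo, reduceB_eq_sum_condB]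
  have h : ∀ k, condB (probe i j w) k = condB (probe i j w) i := fun k => by
    rw [condB_probe hij hw, condB_probe hij hw]
  simp only [h, Finset.sum_const]
  have hH := (posSemidef_condB (isState_probe hij hw).1 i).1
  rw [← Nat.cast_smul_eq_nsmul ℝ, massEntropy_smul hH, nsmul_eq_mul, sub_self]

/-- The witness criterion: if coherences reach the populations in proportions different from those
of the maximally mixed input, correlations are created from none. -/
lemma exists_holevo_pos {s : Finset κ} {K : κ → Matrix A A ℂ} {i j k l : A} (hij : i ≠ j)
    (hne : (∑ μ ∈ s, K μ k i * star (K μ k j)) *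
        ((∑ μ ∈ s, ∑ n, Complex.normSq (K μ l n) : ℝ) : ℂ) ≠
      (∑ μ ∈ s, K μ l i * star (K μ l j)) *
        ((∑ μ ∈ s, ∑ n, Complex.normSq (K μ k n) : ℝ) : ℂ)) :
    ∃ ρ : Matrix (A × Fin 2) (A × Fin 2) ℂ, IsState ρ ∧ classicalCorr ρ = 0 ∧
      0 < holevo (onA (∑ μ ∈ s, krausMap (K μ)) ρ) := by
  set zk := ∑ μ ∈ s, K μ k i * star (K μ k j) with hzk
  set zl := ∑ μ ∈ s, K μ l i * star (K μ l j) with hzl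
  set tk : ℝ := ∑ μ ∈ s, ∑ n, Complex.normSq (K μ k n) with htk
  set tl : ℝ := ∑ μ ∈ s, ∑ n, Complex.normSq (K μ l n) with htl
  set u : ℂ := zk * tl - zl * tk with hu
  have hu0 : (‖u‖ : ℂ) ≠ 0 := by
    rw [Ne, Complex.ofReal_eq_zero, norm_eq_zero]; exact sub_ne_zero.2 hne
  have hun : ‖u‖ ≠ 0 := by exact_mod_cast hu0
  -- The output weights of the sign bit are t_k ± 2 Re(w z_k), up to a common factor. Those for k
  -- and l are proportional only if Re(w u) = 0, so the phase w is chosen to make w u = ‖u‖.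
  set w : ℂ := star u / ‖u‖ with hw
  have hww : w * star w = 1 := by
    rw [hw, star_div₀, star_star, Complex.star_def, Complex.conj_ofReal,
      div_mul_div_comm, mul_comm, Complex.mul_conj, Complex.normSq_eq_norm_sq]
    push_cast
    field_simp
  have hwu : w * u = ‖u‖ := by
    rw [hw, div_mul_eq_mul_div, Complex.star_def, mul_comm, Complex.mul_conj,
      Complex.normSq_eq_norm_sq]
    push_cast
    field_simp
  have hd : (2 * Fintype.card A : ℝ)⁻¹ ≠ 0 := by
    have : Nonempty A := ⟨i⟩
    have : (Fintype.card A : ℝ) ≠ 0 := Nat.cast_ne_zero.2 Fintype.card_ne_zero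
    positivity
  refine ⟨probe i j w, isState_probe hij hww, classicalCorr_probe hij hww, ?_⟩
  rw [probe, onA_blockDiagonal]
  have hpsd : ∀ b : Fin 2, ((∑ μ ∈ s, krausMap (K μ)) ((2 * Fintype.card A : ℝ)⁻¹ •
      withCoherence i j ((![1, -1] : Fin 2 → ℂ) b * w))).PosSemidef := by
    intro b
    rw [LinearMap.sum_apply]
    exact Matrix.posSemidef_sum _ fun μ _ =>
      (posSemidef_probe_block hij hww b).mul_mul_conjTranspose_same (K μ)
  have hentry : ∀ (b : Fin 2) (n : A), ((∑ μ ∈ s, krausMap (K μ)) ((2 * Fintype.card A : ℝ)⁻¹ •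
      withCoherence i j ((![1, -1] : Fin 2 → ℂ) b * w)) n n).re =
      (2 * Fintype.card A : ℝ)⁻¹ * (∑ μ ∈ s, ∑ a, Complex.normSq (K μ n a) +
        2 * ((![1, -1] : Fin 2 → ℂ) b * w * ∑ μ ∈ s, K μ n i * star (K μ n j)).re) := by
    intro b n
    rw [LinearMap.map_smul_of_tower, Matrix.smul_apply, Complex.smul_re,
      sum_krausMap_withCoherence, smul_eq_mul]
  refine holevo_blockDiagonal_pos hpsd (k := k) (l := l) (b := 0) fun heq => hun ?_
  simp only [hentry] at heq
  simp only [Fin.sum_univ_two, Matrix.cons_val_zero, Matrix.cons_val_one, one_mul,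
    neg_mul, Complex.neg_re, ← hzk, ← hzl, ← htk, ← htl] at heq
  have hre : (w * zk).re * tl - (w * zl).re * tk = ‖u‖ := by
    have := congrArg Complex.re hwu
    rw [hu, mul_sub, Complex.sub_re, ← mul_assoc, ← mul_assoc, Complex.re_mul_ofReal,
      Complex.re_mul_ofReal, Complex.ofReal_re] at this
    exact this
  rw [← hre]
  have h4 : (2 * Fintype.card A : ℝ)⁻¹ * (2 * Fintype.card A : ℝ)⁻¹ * 4 *
      ((w * zk).re * tl - (w * zl).re * tk) = 0 := by
    linear_combination heq
  rcases mul_eq_zero.1 h4 with h | h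
  · exact absurd h (by simp only [mul_eq_zero, not_or]; exact ⟨⟨hd, hd⟩, by norm_num⟩)
  · exact h

/-- An incoherent operation that does not commute with dephasing creates classical correlations
from none. -/
theorem exists_classicalCorr_pos {E : Superop A} (hE : IsIncoherentOp E)
    (hcomm : ¬ CommutesWithDephasing E) :
    ∃ ρ : Matrix (A × Fin 2) (A × Fin 2) ℂ, IsState ρ ∧ classicalCorr ρ = 0 ∧
      0 < classicalCorr (onA E ρ) := by
  obtain ⟨m, K, ⟨hK, rfl⟩, hinc⟩ := hE
  have : ∃ k i j, i ≠ j ∧ ∑ μ, K μ k i * star (K μ k j) ≠ 0 := by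
    by_contra! h
    exact hcomm (commutesWithDephasing_sum_krausMap (fun μ _ => hinc μ) h)
  obtain ⟨k, i, j, hij, hz⟩ := this
  suffices ∃ l, (∑ μ, K μ k i * star (K μ k j)) *
        ((∑ μ, ∑ n, Complex.normSq (K μ l n) : ℝ) : ℂ) ≠
      (∑ μ, K μ l i * star (K μ l j)) * ((∑ μ, ∑ n, Complex.normSq (K μ k n) : ℝ) : ℂ) by
    obtain ⟨l, hl⟩ := this
    obtain ⟨ρ, hρ, h0, hpos⟩ := exists_holevo_pos hij hl
    exact ⟨ρ, hρ, h0, by rwa [classicalCorr_eq_holevo (isState_onA_sum_krausMap hK hρ)]⟩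
  by_contra! h
  -- Summing the proportionality over l brings in trace preservation: the row masses add up to tr 1
  -- = dim A and the amplitudes to tr |i⟩⟨j| = 0.
  have hsum := Finset.sum_congr rfl fun l (_ : l ∈ Finset.univ) => h l
  rw [← Finset.mul_sum, ← Finset.sum_mul] at hsum
  have h1 : ∑ l, ((∑ μ, ∑ n, Complex.normSq (K μ l n) : ℝ) : ℂ) = Fintype.card A := by
    simp only [← sum_krausMap_one_diag]
    refine (trace_sum_krausMap Finset.univ K 1).trans ?_
    rw [hK, one_mul, Matrix.trace_one]
  have h2 : ∑ l, ∑ μ, K μ l i * star (K μ l j) = 0 := by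
    simp only [← sum_krausMap_single]
    refine (trace_sum_krausMap Finset.univ K _).trans ?_
    rw [hK, one_mul, Matrix.trace_single_eq_of_ne _ _ _ hij]
  rw [h1, h2, zero_mul, mul_eq_zero] at hsum
  rcases hsum with h | h
  · exact hz h
  · have : Nonempty A := ⟨i⟩
    exact Fintype.card_ne_zero (Nat.cast_eq_zero.1 h)

end Probe

/-! ### Monotonicity forces strict incoherence -/

section Maximality

variable {A : Type} [Fintype A] [DecidableEq A]

/-- All outcomes contribute nonnegatively, so if J starts at zero no single outcome can contribute.
-/
lemma IsEnsembleMonotone.holevo_nonpos {m r n : ℕ} {K : Fin m → Matrix A A ℂ}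
    {g : Fin m → Fin r} (h : IsEnsembleMonotone (recorded K g))
    {ρ : Matrix (A × Fin n) (A × Fin n) ℂ} (hρ : IsState ρ) (h0 : classicalCorr ρ = 0)
    (x : Fin r) : holevo (onA (recorded K g x) ρ) ≤ 0 := by
  have hpsd : ∀ x, (onA (recorded K g x) ρ).PosSemidef := fun x =>
    posSemidef_onA_sum_krausMap _ K hρ.1
  have := h n ρ hρ
  simp only [outcomeProb_mul_classicalCorr (hpsd _)] at this
  rw [h0] at this
  exact (Finset.single_le_sum (fun x _ => holevo_nonneg (hpsd x)) (Finset.mem_univ x)).trans this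

lemma exists_mul_star_ne_zero {K : Matrix A A ℂ} (hK : IsIncoherentKraus K)
    (h : ¬ IsSIKraus K) : ∃ k i j, i ≠ j ∧ K k i * star (K k j) ≠ 0 := by
  by_contra! hz
  have := commutesWithDephasing_sum_krausMap (s := {()}) (K := fun _ => K) (fun _ _ => hK)
    (by simpa using hz)
  rw [Finset.sum_singleton] at this
  exact h ⟨hK, this⟩

/-- Under full record of the outcome, a Kraus operator that is not strictly incoherent must have a
single nonzero row. -/
lemma exists_row_of_not_isSIKraus {m : ℕ} {K : Fin m → Matrix A A ℂ}
    (hinc : ∀ μ, IsIncoherentKraus (K μ)) (hmono : IsEnsembleMonotone (recorded K id))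
    {μ : Fin m} (hμ : ¬ IsSIKraus (K μ)) : ∃ k, ∀ l, l ≠ k → ∀ n, K μ l n = 0 := by
  obtain ⟨k, i, j, hij, hz⟩ := exists_mul_star_ne_zero (hinc μ) hμ
  refine ⟨k, fun l hl n => ?_⟩
  by_contra hn
  -- Column i already has its only nonzero entry in row k. Hence z_l = 0, while z_k and the mass of
  -- row l are nonzero, and the witness criterion applies.
  have hli : K μ l i = 0 := by
    have := (hinc μ).mul_star_eq_zero hl i
    rcases mul_eq_zero.1 this with h | h
    · exact h
    · exact absurd (star_eq_zero.1 h) (left_ne_zero_of_mul hz)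
  have hrow : ∑ n, Complex.normSq (K μ l n) ≠ 0 := fun h => hn <|
    Complex.normSq_eq_zero.1 <| (Finset.sum_eq_zero_iff_of_nonneg
      fun _ _ => Complex.normSq_nonneg _).1 h n (Finset.mem_univ n)
  obtain ⟨ρ, hρ, h0, hpos⟩ := exists_holevo_pos (s := Finset.univ.filter fun ν => id ν = μ)
    (K := K) (k := k) (l := l) hij (by
      simp only [id, Finset.sum_filter, Finset.sum_ite_eq', Finset.mem_univ, if_true, hli,
        zero_mul]
      exact mul_ne_zero hz (Complex.ofReal_ne_zero.2 hrow))
  exact hpos.not_ge (hmono.holevo_nonpos hρ h0 μ)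

lemma krausMap_single (k n : A) (c : ℂ) (M : Matrix A A ℂ) :
    krausMap (Matrix.single k n c) M = Matrix.single k k (c * M n n * star c) := by
  rw [krausMap, LinearMap.coe_mk, AddHom.coe_mk, Matrix.conjTranspose_single,
    Matrix.single_mul_mul_single]

lemma isSIKraus_single (k n : A) (c : ℂ) : IsSIKraus (Matrix.single k n c) := by
  refine ⟨⟨fun _ => k, fun i l hl => ?_⟩, LinearMap.ext fun M => ?_⟩
  · rw [Matrix.single_apply, if_neg]
    exact fun h => hl h.1.symm
  · rw [LinearMap.comp_apply, LinearMap.comp_apply, krausMap_single, krausMap_single,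
      dephase_apply_same]
    ext a b
    by_cases h : a = b
    · rw [h, dephase_apply_same]
    · rw [dephase_apply_ne _ h, Matrix.single_apply, if_neg]
      rintro ⟨rfl, rfl⟩
      exact h rfl

/-- A sum of single-row Kraus maps that commutes with dephasing measures populations and prepares
incoherent states. -/
lemma sum_krausMap_eq_sum_single {κ : Type} [Fintype κ] {K : κ → Matrix A A ℂ}
    (hrow : ∀ μ, ∃ k, ∀ l, l ≠ k → ∀ n, K μ l n = 0)
    (hcomm : CommutesWithDephasing (∑ μ, krausMap (K μ))) :
    ∑ μ, krausMap (K μ) = ∑ p : A × A, krausMap (Matrix.single p.1 p.2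
      ((√(∑ μ, Complex.normSq (K μ p.1 p.2)) : ℝ) : ℂ)) := by
  have hsq : ∀ p : A × A, ((√(∑ μ, Complex.normSq (K μ p.1 p.2)) : ℝ) : ℂ) *
      ((√(∑ μ, Complex.normSq (K μ p.1 p.2)) : ℝ) : ℂ) =
      ∑ μ, K μ p.1 p.2 * star (K μ p.1 p.2) := by
    intro p
    rw [← Complex.ofReal_mul,
      Real.mul_self_sqrt (Finset.sum_nonneg fun _ _ => Complex.normSq_nonneg _)]
    simp [Complex.mul_conj]
  refine LinearMap.ext fun M => ?_
  ext a b
  have hR : (∑ p : A × A, krausMap (Matrix.single p.1 p.2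
      ((√(∑ μ, Complex.normSq (K μ p.1 p.2)) : ℝ) : ℂ))) M a b =
      ∑ k, ∑ n, Matrix.single k k (((√(∑ μ, Complex.normSq (K μ k n)) : ℝ) : ℂ) * M n n *
        star ((√(∑ μ, Complex.normSq (K μ k n)) : ℝ) : ℂ)) a b := by
    rw [LinearMap.sum_apply, Matrix.sum_apply, Fintype.sum_prod_type]
    simp only [krausMap_single]
  rw [hR]
  -- Off the diagonal, single-row operators output nothing; on it, commutation removes the input
  -- coherences and leaves the squared weights.
  by_cases hab : a = b
  · subst hab
    rw [hcomm.apply_diag, sum_krausMap_dephase,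
      Finset.sum_eq_single (s := Finset.univ) a (f := fun k => ∑ n, Matrix.single k k _ a a)]
    · refine Finset.sum_congr rfl fun n _ => ?_
      rw [Matrix.single_apply_same, ← hsq (a, n), Complex.star_def, Complex.conj_ofReal]
      ring
    · intro k _ hk
      exact Finset.sum_eq_zero fun n _ => by simp [hk]
    · simp
  · rw [sum_krausMap_apply]
    trans 0
    · refine Finset.sum_eq_zero fun i _ => Finset.sum_eq_zero fun j _ => ?_
      rw [Finset.sum_eq_zero, mul_zero]
      intro μ _
      obtain ⟨k, hk⟩ := hrow μ
      by_cases hak : a = k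
      · rw [hk b (fun h => hab (hak.trans h.symm)), star_zero, mul_zero]
      · rw [hk a hak, zero_mul]
    · refine (Finset.sum_eq_zero fun k _ => Finset.sum_eq_zero fun n _ => ?_).symm
      rw [Matrix.single_apply, if_neg]
      rintro ⟨rfl, rfl⟩
      exact hab rfl

lemma isSIOp_of_fintype {κ : Type} [Fintype κ] {K : κ → Matrix A A ℂ}
    (hK : ∑ μ, (K μ)ᴴ * K μ = 1) (hSI : ∀ μ, IsSIKraus (K μ)) :
    IsSIOp (∑ μ, krausMap (K μ)) := by
  refine ⟨Fintype.card κ, fun x => K ((Fintype.equivFin κ).symm x), ⟨?_, ?_⟩, fun x => hSI _⟩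
  · rw [← hK]
    exact Equiv.sum_comp (Fintype.equivFin κ).symm fun μ => (K μ)ᴴ * K μ
  · exact (Equiv.sum_comp (Fintype.equivFin κ).symm fun μ => krausMap (K μ)).symm

/-- An incoherent operation under which the classical correlations are an ensemble monotone is
strictly incoherent. -/
theorem IsEnsembleMonotoneUnder.isSIOp {E : Superop A} (h : IsEnsembleMonotoneUnder E) :
    IsSIOp E := by
  classical
  obtain ⟨m, K, ⟨hK, hE⟩, hinc, hmono⟩ := h
  have hcomm : CommutesWithDephasing E := by
    by_contra hc
    obtain ⟨ρ, hρ, h0, hpos⟩ := exists_classicalCorr_pos ⟨m, K, ⟨hK, hE⟩, hinc⟩ hc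
    -- A constant record keeps nothing, so the only suboperation is `E` itself.
    have hle := (hmono 1 fun _ => 0).holevo_nonpos hρ h0 0
    have hrec : recorded K (fun _ => (0 : Fin 1)) 0 = E := by simp [recorded, hE]
    rw [hE, classicalCorr_eq_holevo (isState_onA_sum_krausMap hK hρ), ← hE] at hpos
    rw [hrec] at hle
    exact hpos.not_ge hle
  have hsplit : ∑ μ : {μ // IsSIKraus (K μ)}, krausMap (K μ) +
      ∑ μ : {μ // ¬ IsSIKraus (K μ)}, krausMap (K μ) = E := by
    rw [hE]
    exact Fintype.sum_subtype_add_sum_subtype _ fun μ => krausMap (K μ)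
  have hcommSI : CommutesWithDephasing (∑ μ : {μ // IsSIKraus (K μ)}, krausMap (K μ)) :=
    CommutesWithDephasing.sum fun μ _ => μ.2.2
  -- A non-SI operator need not commute with Φ by itself, but their sum does, being the difference
  -- of two commuting maps.
  have hcommN : CommutesWithDephasing (∑ μ : {μ // ¬ IsSIKraus (K μ)}, krausMap (K μ)) := by
    rw [CommutesWithDephasing] at hcomm hcommSI ⊢
    rw [← hsplit, LinearMap.add_comp, LinearMap.comp_add, hcommSI] at hcomm
    exact add_left_cancel hcomm
  have hN := sum_krausMap_eq_sum_single (K := fun μ : {μ // ¬ IsSIKraus (K μ)} => K μ)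
    (fun μ => exists_row_of_not_isSIKraus hinc (hmono m id) μ.2) hcommN
  let L : {μ // IsSIKraus (K μ)} ⊕ A × A → Matrix A A ℂ := Sum.elim (fun μ => K μ)
    fun p => Matrix.single p.1 p.2
      ((√(∑ μ : {μ // ¬ IsSIKraus (K μ)}, Complex.normSq (K μ p.1 p.2)) : ℝ) : ℂ)
  have hL : ∑ x, krausMap (L x) = E := by
    rw [← hsplit, hN, Fintype.sum_sum_type]
    rfl
  have hLK : ∑ x, (L x)ᴴ * L x = 1 := by
    rw [← hK]
    exact sum_conjTranspose_mul_eq (hL.trans hE)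
  rw [← hL]
  refine isSIOp_of_fintype hLK fun x => ?_
  rcases x with μ | p
  · exact μ.2
  · exact isSIKraus_single _ _ _

end Maximality

end Incoherence

end

theorem mainTheorem5 (A : Type) [Fintype A] [DecidableEq A] :
    -- the SI operations are the largest set of incoherent operations under which `J(B|A)` is an
    -- ensemble monotone
    IsGreatest
      {S : Set (Incoherence.Superop A) |
        (∀ E ∈ S, Incoherence.IsIncoherentOp E) ∧
          ∀ E ∈ S, Incoherence.IsEnsembleMonotoneUnder E}
      {E : Incoherence.Superop A | Incoherence.IsSIOp E} ∧
    -- for SI operations every SI Kraus representation, with any record of the outcome, will do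
    (∀ (m : ℕ) (K : Fin m → Matrix A A ℂ), ∑ μ, (K μ)ᴴ * K μ = 1 →
      (∀ μ, Incoherence.IsSIKraus (K μ)) →
      ∀ (r : ℕ) (g : Fin m → Fin r), Incoherence.IsEnsembleMonotone (Incoherence.recorded K g)) ∧
    -- an incoherent operation that does not commute with dephasing can increase `J(B|A)` from zero
    (∀ E : Incoherence.Superop A, Incoherence.IsIncoherentOp E →
      ¬ Incoherence.CommutesWithDephasing E →
      ∃ ρ : Matrix (A × Fin 2) (A × Fin 2) ℂ, Incoherence.IsState ρ ∧
        Incoherence.classicalCorr ρ = 0 ∧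
        0 < Incoherence.classicalCorr (Incoherence.onA E ρ)) := by
  refine ⟨⟨⟨?_, ?_⟩, ?_⟩, ?_, ?_⟩
  · rintro E ⟨m, K, hK, hSI⟩
    exact ⟨m, K, hK, fun μ => (hSI μ).1⟩
  · rintro E ⟨m, K, hK, hSI⟩
    exact ⟨m, K, hK, fun μ => (hSI μ).1,
      fun r g => Incoherence.isEnsembleMonotone_recorded hK.1 hSI g⟩
  · rintro S ⟨-, hS⟩ E hE
    exact (hS E hE).isSIOp
  · intro m K hK hSI r g
    exact Incoherence.isEnsembleMonotone_recorded hK hSI g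
  · intro E hE hcomm
    exact Incoherence.exists_classicalCorr_pos hE hcomm
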